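/- For $m\in\mathbb N=\{0,1,2,\dots\}$ and $c,d\in\mathbb C$ let $G_m[c\!:\!d](x_1,x_2)=\mathcal G^{1,0}_{1;m}[c\!:\!d](x_1,x_2)=c\,\bigl(x_1^m+x_2^m-(x_1+x_2)^m\bigr)$, so that $G_m[c\!:\!d](1,y)=c\,\bigl(1+y^m-(1+y)^m\bigr)$. Call a polynomial $H\in\mathbb C[x_1,x_2]$ proper if it is symmetric in $x_1,x_2$; let $m(H)$ be the set of all $m\in\mathbb N$ for which there are $c,d\in\mathbb C$ such that $G_m[c\!:\!d]$ is not identically zero and $H$ divides $G_m[c\!:\!d]$ (thus $c\neq0$ and $m\neq1$); and let $\mathcal H_n$ be the set of all proper $H$ such that $m(H)$ is infinite with smallest element $n$. (i) The proper $H$ with $m(H)$ infinite are exactly the polynomials $$H=C\,(x_1x_2)^{\alpha}(x_1+x_2)^{\beta}(x_1^2+x_1x_2+x_2^2)^{\gamma},\qquad C\in\mathbb C\setminus\{0\},\ \alpha,\beta\in\{0,1\},\ \gamma\in\{0,1,2\}.$$ Accordingly, the polynomials $H(1,y)$ obtained from them are exactly the polynomials $C\,y^{\alpha}(1+y)^{\beta}(1+y+y^2)^{\gamma}$,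 that is, up to constants, the products of $y$, $1+y$ (each used at most once) and at most one of $1+y+y^2$, $(1+y+y^2)^2$. (ii) For such an $H$, the set $m(H)$ consists of all $m\neq1$ that satisfy the conditions of the factors of $H$: $m>1$ if $\alpha=1$; $m\equiv1\bmod 2$ if $\beta=1$; $m\equiv1,5\bmod 6$ if $\gamma=1$; $m\equiv1\bmod 6$ if $\gamma=2$. For $m\neq1$ and $c\neq0$ the same conditions are necessary and sufficient for $H(1,y)$ to divide $G_m[c\!:\!d](1,y)$ in $\mathbb C[y]$. (iii) In particular $x_1x_2\in\mathcal H_2$, $x_1+x_2\in\mathcal H_3$, $x_1^2+x_1x_2+x_2^2\in\mathcal H_5$ and $(x_1^2+x_1x_2+x_2^2)^2\in\mathcal H_7$; at $(x_1,x_2)=(1,y)$ these are $y$, $1+y$, $1+y+y^2$ and $(1+y+y^2)^2$. -/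

import Mathlib

/-- The function `G^{i,j}_{1;n}[a:b](x, y) = a (x₁ⁿ + ⋯ + x_pⁿ) + b (y₁ⁿ + ⋯ + y_qⁿ)
- a (x₁ + ⋯ + x_p + y₁ + ⋯ + y_q)ⁿ`, where `p = i + 1` is the number of `x` symbols and
`q = j` the number of `y` symbols. -/
noncomputable def gFun (p q n : ℕ) (a b : ℂ) : MvPolynomial (Fin p ⊕ Fin q) ℂ :=
  MvPolynomial.C a * ∑ i : Fin p, MvPolynomial.X (Sum.inl i) ^ n
    + MvPolynomial.C b * ∑ j : Fin q, MvPolynomial.X (Sum.inr j) ^ n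
    - MvPolynomial.C a *
      (∑ i : Fin p, MvPolynomial.X (Sum.inl i) + ∑ j : Fin q, MvPolynomial.X (Sum.inr j)) ^ n

/-- A polynomial is proper if it is symmetric in the `x` symbols and in the `y` symbols. -/
def IsProper {p q : ℕ} (H : MvPolynomial (Fin p ⊕ Fin q) ℂ) : Prop :=
  ∀ (σ : Equiv.Perm (Fin p)) (τ : Equiv.Perm (Fin q)),
    MvPolynomial.rename (Sum.map σ τ) H = H

/-- The set `m(H)` of the orders `m` at which `H` divides a function `G_m[c:d]`; the identically
vanishing functions, which everything divides, are left out. -/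
def orders {p q : ℕ} (H : MvPolynomial (Fin p ⊕ Fin q) ℂ) : Set ℕ :=
  {m | ∃ c d : ℂ, gFun p q m c d ≠ 0 ∧ H ∣ gFun p q m c d}

/-- The class `ℋ_n` of the proper `H` with `m(H)` infinite whose smallest element is `n`. -/
def classH (p q n : ℕ) : Set (MvPolynomial (Fin p ⊕ Fin q) ℂ) :=
  {H | IsProper H ∧ (orders H).Infinite ∧ IsLeast (orders H) n}

/-- The symbol `x₁`, in the case of two `x` symbols and no `y` symbols. -/
noncomputable def x₁ : MvPolynomial (Fin 2 ⊕ Fin 0) ℂ := MvPolynomial.X (Sum.inl 0)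

/-- The symbol `x₂`, in the case of two `x` symbols and no `y` symbols. -/
noncomputable def x₂ : MvPolynomial (Fin 2 ⊕ Fin 0) ℂ := MvPolynomial.X (Sum.inl 1)

/-- The substitution `H ↦ H(1, y)`. -/
noncomputable def atOne : MvPolynomial (Fin 2 ⊕ Fin 0) ℂ →ₐ[ℂ] Polynomial ℂ :=
  MvPolynomial.aeval (Sum.elim ![1, Polynomial.X] Fin.elim0)

/-- The homogeneous product `(x₁x₂)^α (x₁+x₂)^β (x₁²+x₁x₂+x₂²)^γ`. -/
noncomputable def prodXX (α β γ : ℕ) : MvPolynomial (Fin 2 ⊕ Fin 0) ℂ :=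
  (x₁ * x₂) ^ α * (x₁ + x₂) ^ β * (x₁ ^ 2 + x₁ * x₂ + x₂ ^ 2) ^ γ

/-- The product `y^α (1+y)^β (1+y+y²)^γ`. -/
noncomputable def prodY (α β γ : ℕ) : Polynomial ℂ :=
  Polynomial.X ^ α * (1 + Polynomial.X) ^ β * (1 + Polynomial.X + Polynomial.X ^ 2) ^ γ

/-- The conditions on the order `m` that belong to the factors of a product. -/
def OrderCond (α β γ m : ℕ) : Prop :=
  (α = 1 → 1 < m) ∧ (β = 1 → m ≡ 1 [MOD 2]) ∧
    (γ = 1 → m ≡ 1 [MOD 6] ∨ m ≡ 5 [MOD 6]) ∧ (γ = 2 → m ≡ 1 [MOD 6])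

/-! A divisor of a nonzero form is a form, and a symmetric form is determined by `H(1,y)`, so
everything reduces to divisors of `1 + y^m - (1+y)^m`.

The hard point is that a root `a` common to infinitely many of these, other than `0` and `-1`, is a
primitive cube root of unity (`eq_of_infinite_one_add_pow_eq`). Such an `a` is algebraic; embed
`ℚ(a)` in `PadicAlgCl p` for a large prime `p`, where the equation makes `a` and `1 + a` units. A
three-term Skolem–Mahler–Lech argument, resting on a Strassmann theorem for falling-factorial
series, shows that both are roots of unity. In `ℂ` then `|a| = |1 + a| = 1`, which gives `1 + a + a²
= 0`.

Derivatives bound the multiplicities by 1, 1 and 2, and periodicity modulo 6 gives the orders.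
Symmetry of `H` makes the multiplicities at the two cube roots, which are inverse to each other,
equal. -/

/-! ### Strassmann's theorem for falling-factorial series -/

/-- The last index with norm at least `‖e i‖` works; its norm need not be the maximum. -/
theorem exists_forall_gt_norm_lt_of_tendsto_zero {K : Type*} [NormedField K] {e : ℕ → K}
    (he : Filter.Tendsto e Filter.atTop (nhds 0)) {i : ℕ} (hi : e i ≠ 0) :
    ∃ n, e n ≠ 0 ∧ ∀ j, n < j → ‖e j‖ < ‖e n‖ := by
  have hev : ∀ᶠ j in Filter.atTop, ‖e j‖ < ‖e i‖ :=
    (tendsto_zero_iff_norm_tendsto_zero.mp he).eventually_lt_const (norm_pos_iff.mpr hi)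
  obtain ⟨N, hN⟩ := Filter.eventually_atTop.mp hev
  have hfin : {j | ‖e i‖ ≤ ‖e j‖}.Finite := by
    refine (Set.finite_Iio N).subset fun j hj => ?_
    by_contra hlt
    exact absurd (hN j (not_lt.mp hlt)) (not_lt.mpr hj)
  obtain ⟨n, hn, hmax⟩ := hfin.exists_maximal ⟨i, le_refl ‖e i‖⟩
  refine ⟨n, fun h0 => ?_, fun j hj => ?_⟩
  · have : ‖e i‖ ≤ ‖e n‖ := hn
    rw [h0, norm_zero] at this
    exact hi (norm_le_zero_iff.mp this)
  · by_contra hlt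
    have h1 : ‖e i‖ ≤ ‖e j‖ := le_trans hn (not_lt.mp hlt)
    exact absurd (hmax h1 hj.le) (not_le.mpr hj)

/-- A form of Strassmann's theorem: a series of falling factorials with coefficients tending to
zero that vanishes at infinitely many natural numbers is zero. -/
theorem eq_zero_of_infinite_zeros_descFactorial {K : Type*} [NormedField K] [IsUltrametricDist K]
    [CharZero K] {e : ℕ → K} (he : Filter.Tendsto e Filter.atTop (nhds 0))
    (hinf : {k : ℕ | ∑ j ∈ Finset.range (k + 1), e j * (k.descFactorial j : K) = 0}.Infinite)
    (i : ℕ) : e i = 0 := by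
  by_contra hi
  obtain ⟨n, hn, hlt⟩ := exists_forall_gt_norm_lt_of_tendsto_zero he hi
  obtain ⟨S, hS, hcard⟩ := hinf.exists_subset_card_eq (n + 1)
  -- Division by the monic `Q` keeps integer coefficients, hence norms at most 1, and the values on
  -- the `n + 1` zeros in `S`, while the degree drops to at most `n`.
  let Q : Polynomial ℤ := ∏ k ∈ S, (Polynomial.X - Polynomial.C (k : ℤ))
  have hQm : Q.Monic := Polynomial.monic_prod_of_monic _ _ fun k _ => Polynomial.monic_X_sub_C _
  have hQd : Q.natDegree = n + 1 := by
    rw [Polynomial.natDegree_prod_of_monic _ _ fun k _ => Polynomial.monic_X_sub_C _]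
    simp only [Polynomial.natDegree_X_sub_C, Finset.sum_const, hcard, smul_eq_mul, mul_one]
  have hQ1 : Q ≠ 1 := by
    intro h
    rw [h, Polynomial.natDegree_one] at hQd
    omega
  let R : ℕ → Polynomial ℤ := fun j => descPochhammer ℤ j %ₘ Q
  have hRd : ∀ j, (R j).natDegree < n + 1 := fun j =>
    hQd ▸ Polynomial.natDegree_modByMonic_lt _ hQm hQ1
  have hRev : ∀ j, ∀ k ∈ S, (R j).eval (k : ℤ) = (k.descFactorial j : ℤ) := by
    intro j k hk
    rw [← descPochhammer_eval_eq_descFactorial]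
    conv_rhs => rw [← Polynomial.modByMonic_add_div (descPochhammer ℤ j) Q]
    have : Q.eval (k : ℤ) = 0 := by
      rw [Polynomial.eval_prod]
      exact Finset.prod_eq_zero hk (by simp)
    simp [R, this]
  have hRevK : ∀ j, ∀ k ∈ S, ((R j).map (Int.castRingHom K)).eval (k : K) =
      (k.descFactorial j : K) := by
    intro j k hk
    have := Polynomial.eval_intCast_map (Int.castRingHom K) (R j) (k : ℤ)
    rwa [Int.cast_natCast, Int.cast_natCast, hRev j k hk, map_natCast] at this
  have hRself : ∀ j, j ≤ n → R j = descPochhammer ℤ j := by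
    intro j hj
    refine (Polynomial.modByMonic_eq_self_iff hQm).mpr (Polynomial.degree_lt_degree ?_)
    rw [hQd, descPochhammer_natDegree]
    omega
  -- This cutoff exceeds `n` and every `k ∈ S`; terms with `j > k` vanish at `k`.
  let J := max (S.sup id) n + 1
  let F : Polynomial K := ∑ j ∈ Finset.range J,
    Polynomial.C (e j) * (R j).map (Int.castRingHom K)
  have hFd : F.natDegree < n + 1 := by
    refine Nat.lt_succ_of_le (Polynomial.natDegree_sum_le_of_forall_le _ _ fun j _ => ?_)
    refine (Polynomial.natDegree_C_mul_le _ _).trans (Polynomial.natDegree_map_le.trans ?_)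
    exact Nat.lt_succ_iff.mp (hRd j)
  have hFev : ∀ k ∈ S, F.eval (k : K) = 0 := by
    intro k hk
    have h0 : ∑ j ∈ Finset.range (k + 1), e j * (k.descFactorial j : K) = 0 := hS hk
    have hkJ : k + 1 ≤ J := by
      have : k ≤ S.sup id := Finset.le_sup (f := id) hk
      omega
    rw [← h0, Polynomial.eval_finsetSum]
    refine (Finset.sum_subset_zero_on_sdiff (Finset.range_subset_range.mpr hkJ) ?_ ?_).symm
    · intro j hj
      simp only [Finset.mem_sdiff, Finset.mem_range, not_lt] at hj
      rw [Polynomial.eval_mul, hRevK j k hk, Nat.descFactorial_eq_zero_iff_lt.mpr (by omega),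
        Nat.cast_zero, mul_zero]
    · intro j _
      rw [Polynomial.eval_mul, hRevK j k hk, Polynomial.eval_C]
  have hF0 : F = 0 := by
    refine Polynomial.eq_zero_of_natDegree_lt_card_of_eval_eq_zero' F
      (S.map ⟨(Nat.cast : ℕ → K), Nat.cast_injective⟩) ?_ ?_
    · simpa using hFev
    · simpa [hcard] using hFd
  -- The coefficient of `X ^ n` in `F = 0` writes `-e n` as an integral combination of the `e j`
  -- with `j > n`, against the strict dominance of `e n`.
  have hcoeff : ∑ j ∈ Finset.range J, e j * (((R j).coeff n : ℤ) : K) = 0 := by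
    have := congrArg (fun f => Polynomial.coeff f n) hF0
    simpa [F, Polynomial.finsetSum_coeff] using this
  have hlow : ∀ j, j < n → (R j).coeff n = 0 := by
    intro j hj
    rw [hRself j hj.le]
    exact Polynomial.coeff_eq_zero_of_natDegree_lt (by rwa [descPochhammer_natDegree])
  have htop : (R n).coeff n = 1 := by
    rw [hRself n le_rfl]
    have := monic_descPochhammer ℤ n
    rwa [Polynomial.Monic, Polynomial.leadingCoeff, descPochhammer_natDegree] at this
  have hnJ : n ∈ Finset.range J := Finset.mem_range.mpr (by omega)
  rw [← Finset.add_sum_erase _ _ hnJ, htop, Int.cast_one, mul_one] at hcoeff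
  have hnorm : ‖e n‖ = ‖∑ j ∈ (Finset.range J).erase n, e j * (((R j).coeff n : ℤ) : K)‖ := by
    rw [eq_neg_of_add_eq_zero_left hcoeff, norm_neg]
  have hpos : 0 < ‖e n‖ := norm_pos_iff.mpr hn
  have : ‖∑ j ∈ (Finset.range J).erase n, e j * (((R j).coeff n : ℤ) : K)‖ < ‖e n‖ := by
    rcases ((Finset.range J).erase n).eq_empty_or_nonempty with hs | hs
    · simpa [hs] using hpos
    obtain ⟨j, hj, hle⟩ := IsUltrametricDist.exists_norm_finsetSum_le_of_nonempty hs
      fun j => e j * (((R j).coeff n : ℤ) : K)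
    refine hle.trans_lt ?_
    rcases lt_or_gt_of_ne (Finset.ne_of_mem_erase hj) with h | h
    · simpa [hlow j h] using hpos
    · rw [norm_mul]
      refine lt_of_le_of_lt ?_ (hlt j h)
      exact mul_le_of_le_one_right (norm_nonneg _) (IsUltrametricDist.norm_intCast_le_one K _)
  exact absurd hnorm this.ne'

/-! ### Three-term Skolem–Mahler–Lech for p-adic units -/

theorem one_add_mul_pow_eq_sum_descFactorial {K : Type*} [Field K] [CharZero K] (u : K) (k : ℕ) :
    (1 + u) ^ k = ∑ j ∈ Finset.range (k + 1), u ^ j / (j.factorial : K) *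
      (k.descFactorial j : K) := by
  rw [add_comm, add_pow]
  refine Finset.sum_congr rfl fun j _ => ?_
  have : (j.factorial : K) ≠ 0 := Nat.cast_ne_zero.mpr j.factorial_ne_zero
  rw [Nat.descFactorial_eq_factorial_mul_choose, Nat.cast_mul, one_pow]
  field_simp

/-- By compactness the pairs `(a ^ n, b ^ n)` have a Cauchy subsequence; dividing two close terms
gives the power. -/
theorem exists_pow_near_one {K : Type*} [NormedField K] [ProperSpace K] {a b : K} (ha : ‖a‖ = 1)
    (hb : ‖b‖ = 1) {ε : ℝ} (hε : 0 < ε) :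
    ∃ M, 0 < M ∧ ‖a ^ M - 1‖ < ε ∧ ‖b ^ M - 1‖ < ε := by
  have hbd : ∀ n, (a ^ n, b ^ n) ∈ Metric.closedBall (0 : K × K) 1 := by
    intro n
    rw [mem_closedBall_zero_iff, Prod.norm_def]
    simp [ha, hb]
  obtain ⟨x, -, φ, hφ, hlim⟩ := tendsto_subseq_of_bounded Metric.isBounded_closedBall hbd
  obtain ⟨N, hN⟩ := Metric.cauchySeq_iff.mp hlim.cauchySeq ε hε
  have h := hN (N + 1) (Nat.le_succ N) N le_rfl
  have hlt : φ N < φ (N + 1) := hφ (Nat.lt_succ_self N)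
  obtain ⟨M, hM⟩ := Nat.exists_eq_add_of_lt hlt
  refine ⟨M + 1, Nat.succ_pos M, ?_⟩
  have key : ∀ {c : K}, ‖c‖ = 1 → ‖c ^ (M + 1) - 1‖ = dist (c ^ φ (N + 1)) (c ^ φ N) := by
    intro c hc
    rw [dist_eq_norm, hM, show φ N + M + 1 = φ N + (M + 1) by ring, pow_add _ (φ N),
      show c ^ φ N * c ^ (M + 1) - c ^ φ N = c ^ φ N * (c ^ (M + 1) - 1) by ring, norm_mul,
      norm_pow, hc, one_pow, one_mul]
  rw [key ha, key hb]
  simpa [Prod.dist_eq] using h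

theorem PadicAlgCl.inv_norm_factorial_le (p : ℕ) [Fact p.Prime] (j : ℕ) :
    ‖(j.factorial : PadicAlgCl p)‖⁻¹ ≤ (p : ℝ) ^ j := by
  have h : ‖(j.factorial : PadicAlgCl p)‖ = ‖(j.factorial : ℚ_[p])‖ := by
    rw [← PadicAlgCl.norm_extends p, map_natCast]
  rw [h, Padic.norm_eq_zpow_neg_valuation (p := p) (Nat.cast_ne_zero.mpr j.factorial_ne_zero),
    zpow_neg, inv_inv, Padic.valuation_natCast, zpow_natCast]
  exact pow_le_pow_right₀ (by exact_mod_cast (Fact.out : p.Prime).one_le)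
    (padicValNat_factorial_le p j)

/-- The crude bound `v_p(j!) ≤ j` suffices, since `u` may be taken as small as desired. -/
theorem PadicAlgCl.tendsto_pow_div_factorial (p : ℕ) [Fact p.Prime] {u : PadicAlgCl p}
    (hu : ‖u‖ < (p : ℝ)⁻¹) :
    Filter.Tendsto (fun j : ℕ => u ^ j / (j.factorial : PadicAlgCl p)) Filter.atTop (nhds 0) := by
  have hp : (0 : ℝ) < p := by exact_mod_cast (Fact.out : p.Prime).pos
  refine squeeze_zero_norm (a := fun j : ℕ => (‖u‖ * p) ^ j) (fun j => ?_) ?_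
  · rw [norm_div, norm_pow, div_eq_mul_inv, mul_pow]
    exact mul_le_mul_of_nonneg_left (PadicAlgCl.inv_norm_factorial_le p j) (by positivity)
  · refine tendsto_pow_atTop_nhds_zero_of_lt_one (by positivity) ?_
    calc ‖u‖ * p < (p : ℝ)⁻¹ * p := mul_lt_mul_of_pos_right hu hp
      _ = 1 := inv_mul_cancel₀ hp.ne'

/-- Compactness is available in the finite extension of `ℚ_[p]` generated by `a` and `b`. -/
theorem PadicAlgCl.exists_pow_near_one (p : ℕ) [Fact p.Prime] {a b : PadicAlgCl p} (ha : ‖a‖ = 1)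
    (hb : ‖b‖ = 1) {ε : ℝ} (hε : 0 < ε) :
    ∃ M, 0 < M ∧ ‖a ^ M - 1‖ < ε ∧ ‖b ^ M - 1‖ < ε := by
  let L := IntermediateField.adjoin ℚ_[p] ({a, b} : Set (PadicAlgCl p))
  have : FiniteDimensional ℚ_[p] L := IntermediateField.finiteDimensional_adjoin fun x _ =>
    (Algebra.IsAlgebraic.isAlgebraic x).isIntegral
  have : ProperSpace L := FiniteDimensional.proper ℚ_[p] L
  let a' : L := ⟨a, IntermediateField.subset_adjoin _ _ (by simp)⟩
  let b' : L := ⟨b, IntermediateField.subset_adjoin _ _ (by simp)⟩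
  obtain ⟨M, hM, h1, h2⟩ := _root_.exists_pow_near_one (a := a') (b := b') ha hb hε
  exact ⟨M, hM, h1, h2⟩

/-- The case of three terms of the Skolem–Mahler–Lech theorem, for units of the algebraic
closure of `ℚ_p`. -/
theorem PadicAlgCl.exists_pow_eq_one_of_infinite (p : ℕ) [Fact p.Prime] {a b : PadicAlgCl p}
    (ha : ‖a‖ = 1) (hb : ‖b‖ = 1) (hinf : {m : ℕ | 1 + a ^ m = b ^ m}.Infinite) :
    ∃ M, 0 < M ∧ a ^ M = 1 ∧ b ^ M = 1 := by
  have hp : (0 : ℝ) < (p : ℝ)⁻¹ := by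
    have : (0 : ℝ) < p := by exact_mod_cast (Fact.out : p.Prime).pos
    positivity
  obtain ⟨M, hM, hMa, hMb⟩ := PadicAlgCl.exists_pow_near_one p ha hb hp
  -- Pigeonhole: some residue class modulo `M` contains infinitely many solutions.
  obtain ⟨r, hr⟩ : ∃ r, {k : ℕ | 1 + a ^ (r + M * k) = b ^ (r + M * k)}.Infinite := by
    by_contra! hfin
    refine hinf (Set.Finite.subset (Set.Finite.biUnion (Set.finite_Iio M) fun r _ =>
      ((hfin r).image fun k => r + M * k)) fun m hm => ?_)
    simp only [Set.mem_iUnion, Set.mem_image]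
    refine ⟨m % M, Nat.mod_lt m hM, m / M, ?_, Nat.mod_add_div m M⟩
    simpa only [Set.mem_ofPred_eq, Nat.mod_add_div] using hm
  set u := a ^ M - 1 with hu
  set w := b ^ M - 1 with hw
  -- Falling-factorial coefficients of `k ↦ 1 + a ^ (r + M * k) - b ^ (r + M * k)`.
  let e : ℕ → PadicAlgCl p := fun j => (if j = 0 then 1 else 0) +
    a ^ r * (u ^ j / (j.factorial : PadicAlgCl p)) - b ^ r * (w ^ j / (j.factorial : PadicAlgCl p))
  have he : Filter.Tendsto e Filter.atTop (nhds 0) := by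
    have h1 : Filter.Tendsto (fun j : ℕ => if j = 0 then (1 : PadicAlgCl p) else 0)
        Filter.atTop (nhds 0) := by
      refine tendsto_const_nhds.congr' ?_
      filter_upwards [Filter.eventually_gt_atTop 0] with j hj
      rw [if_neg hj.ne']
    have h2 := (PadicAlgCl.tendsto_pow_div_factorial p hMa).const_mul (a ^ r)
    have h3 := (PadicAlgCl.tendsto_pow_div_factorial p hMb).const_mul (b ^ r)
    simpa using (h1.add h2).sub h3
  have hsum : ∀ k : ℕ, ∑ j ∈ Finset.range (k + 1), e j * (k.descFactorial j : PadicAlgCl p) =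
      1 + a ^ (r + M * k) - b ^ (r + M * k) := by
    intro k
    have h1 : ∑ j ∈ Finset.range (k + 1),
        (if j = 0 then (1 : PadicAlgCl p) else 0) * (k.descFactorial j : PadicAlgCl p) = 1 := by
      rw [Finset.sum_eq_single 0] <;> simp +contextual
    rw [pow_add, pow_mul, pow_add, pow_mul, show a ^ M = 1 + u by rw [hu]; ring,
      show b ^ M = 1 + w by rw [hw]; ring, one_add_mul_pow_eq_sum_descFactorial u,
      one_add_mul_pow_eq_sum_descFactorial w, ← h1, Finset.mul_sum, Finset.mul_sum,
      ← Finset.sum_add_distrib, ← Finset.sum_sub_distrib]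
    exact Finset.sum_congr rfl fun j _ => by simp only [e]; ring
  have hzero := eq_zero_of_infinite_zeros_descFactorial he
    (hr.mono fun k hk => by
      simp only [Set.mem_ofPred_eq] at hk ⊢
      rw [hsum, hk, sub_self])
  have h0 : 1 + a ^ r - b ^ r = 0 := by simpa [e] using hzero 0
  have h1 : a ^ r * u - b ^ r * w = 0 := by simpa [e] using hzero 1
  have h2 : a ^ r * u ^ 2 - b ^ r * w ^ 2 = 0 := by
    have := hzero 2
    simp only [e, OfNat.ofNat_ne_zero, if_false] at this
    have h2 : ((Nat.factorial 2 : ℕ) : PadicAlgCl p) ≠ 0 :=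
      Nat.cast_ne_zero.mpr (Nat.factorial_ne_zero 2)
    field_simp at this
    linear_combination this
  have ha0 : a ^ r ≠ 0 := pow_ne_zero _ (norm_ne_zero_iff.mp (by rw [ha]; exact one_ne_zero))
  have hb0 : b ^ r ≠ 0 := pow_ne_zero _ (norm_ne_zero_iff.mp (by rw [hb]; exact one_ne_zero))
  -- If `w ≠ 0`, coefficients 1 and 2 force `u = w`, then `a ^ r = b ^ r`, and coefficient 0 becomes
  -- `1 = 0`.
  have hw0 : w = 0 := by
    by_contra hne
    have huw : b ^ r * w * (u - w) = 0 := by linear_combination h2 - u * h1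
    have huw' : u = w := sub_eq_zero.mp
      ((mul_eq_zero.mp huw).resolve_left (mul_ne_zero hb0 hne))
    have h3 : (a ^ r - b ^ r) * w = 0 := by rw [huw'] at h1; linear_combination h1
    have h4 := (mul_eq_zero.mp h3).resolve_right hne
    exact one_ne_zero (α := PadicAlgCl p) (by linear_combination h0 - h4)
  have hu0 : u = 0 := by
    rw [hw0, mul_zero, sub_zero] at h1
    exact (mul_eq_zero.mp h1).resolve_left ha0
  exact ⟨M, hM, sub_eq_zero.mp hu0, sub_eq_zero.mp hw0⟩

/-! ### Solutions of `1 + a^m = (1 + a)^m` are units -/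

theorem exists_one_add_pow_eq_of_norm_le_one {K : Type*} [NormedField K] [IsUltrametricDist K]
    {a : K} (ha : ‖a‖ ≤ 1) (m : ℕ) : ∃ s : K, ‖s‖ ≤ 1 ∧ (1 + a) ^ m = 1 + m * a + a ^ 2 * s := by
  induction m with
  | zero => exact ⟨0, by simp, by simp⟩
  | succ m ih =>
    obtain ⟨s, hs, h⟩ := ih
    refine ⟨m + s + a * s, ?_, by rw [pow_succ, h]; push_cast; ring⟩
    have has : ‖a * s‖ ≤ 1 := by
      rw [norm_mul]
      exact mul_le_one₀ ha (norm_nonneg _) hs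
    refine (IsUltrametricDist.norm_add_le_max _ _).trans (max_le ?_ has)
    exact (IsUltrametricDist.norm_add_le_max _ _).trans
      (max_le (IsUltrametricDist.norm_natCast_le_one K m) hs)

/-- If `‖a‖ < 1`, cancelling `a` in the second-order expansion makes `m` a multiple of `a` by an
integral element, so `‖m‖ < 1`. -/
theorem one_le_norm_of_one_add_pow_eq {K : Type*} [NormedField K] [IsUltrametricDist K]
    {a : K} (ha : a ≠ 0) {m : ℕ} (hm : 2 ≤ m) (hmK : ‖(m : K)‖ = 1)
    (h : 1 + a ^ m = (1 + a) ^ m) : 1 ≤ ‖a‖ := by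
  by_contra! hlt
  obtain ⟨s, hs, hsum⟩ := exists_one_add_pow_eq_of_norm_le_one hlt.le m
  obtain ⟨k, rfl⟩ := Nat.exists_eq_add_of_le hm
  have hma : ((2 + k : ℕ) : K) = a * (a ^ k - s) := by
    refine mul_left_cancel₀ ha ?_
    rw [hsum, pow_add] at h
    linear_combination -h
  have hle : ‖a ^ k - s‖ ≤ 1 := by
    rw [sub_eq_add_neg]
    refine (IsUltrametricDist.norm_add_le_max _ _).trans (max_le ?_ (by rwa [norm_neg]))
    rw [norm_pow]
    exact pow_le_one₀ (norm_nonneg _) hlt.le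
  rw [hma, norm_mul] at hmK
  have : ‖a‖ * ‖a ^ k - s‖ ≤ ‖a‖ := mul_le_of_le_one_right (norm_nonneg _) hle
  linarith

/-- The equation is invariant under `a ↦ a⁻¹`, which turns the lower bound into an upper one. -/
theorem norm_eq_one_of_one_add_pow_eq {K : Type*} [NormedField K] [IsUltrametricDist K]
    {a : K} (ha : a ≠ 0) {m : ℕ} (hm : 2 ≤ m) (hmK : ‖(m : K)‖ = 1)
    (h : 1 + a ^ m = (1 + a) ^ m) : ‖a‖ = 1 := by
  refine le_antisymm ?_ (one_le_norm_of_one_add_pow_eq ha hm hmK h)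
  have hinv : 1 + a⁻¹ ^ m = (1 + a⁻¹) ^ m := by
    have h1 : 1 + a⁻¹ = (1 + a) * a⁻¹ := by field_simp; ring
    rw [h1, mul_pow, ← h, add_mul, one_mul, ← mul_pow, mul_inv_cancel₀ ha, one_pow, add_comm]
  have := one_le_norm_of_one_add_pow_eq (inv_ne_zero ha) hm hmK hinv
  rw [norm_inv] at this
  exact (one_le_inv₀ (norm_pos_iff.mpr ha)).mp this

/-- For odd `m` the equation is invariant under `a ↦ -(1 + a)`. For even `m`, expanding `a ^ m = (1
- (1 + a)) ^ m` makes 2 an integral multiple of `1 + a`, so `‖1 + a‖ < 1` would contradict `‖2‖ =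
1`. -/
theorem norm_one_add_eq_one_of_one_add_pow_eq {K : Type*} [NormedField K] [IsUltrametricDist K]
    {a : K} (ha : a ≠ 0) (hb : 1 + a ≠ 0) {m : ℕ} (hm : 2 ≤ m) (h2K : ‖(2 : K)‖ = 1)
    (hmK : ‖(m : K)‖ = 1) (h : 1 + a ^ m = (1 + a) ^ m) : ‖1 + a‖ = 1 := by
  rcases m.even_or_odd with hev | hodd
  · have hle : ‖1 + a‖ ≤ 1 := (IsUltrametricDist.norm_add_le_max _ _).trans
      (max_le norm_one.le (norm_eq_one_of_one_add_pow_eq ha hm hmK h).le)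
    refine le_antisymm hle ?_
    by_contra! hlt
    obtain ⟨s, hs, hsum⟩ := exists_one_add_pow_eq_of_norm_le_one
      (a := -(1 + a)) (by rwa [norm_neg]) m
    rw [show 1 + -(1 + a) = -a by ring, hev.neg_pow] at hsum
    obtain ⟨k, rfl⟩ := Nat.exists_eq_add_of_le hm
    have h2 : (2 : K) = (1 + a) * ((1 + a) * ((1 + a) ^ k - s) + (2 + k : ℕ)) := by
      rw [hsum, pow_add (1 + a)] at h
      linear_combination h
    have hle1 : ‖(1 + a) ^ k - s‖ ≤ 1 := by
      rw [sub_eq_add_neg]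
      refine (IsUltrametricDist.norm_add_le_max _ _).trans (max_le ?_ (by rwa [norm_neg]))
      rw [norm_pow]
      exact pow_le_one₀ (norm_nonneg _) hle
    have hle2 : ‖(1 + a) * ((1 + a) ^ k - s) + (2 + k : ℕ)‖ ≤ 1 := by
      refine (IsUltrametricDist.norm_add_le_max _ _).trans (max_le ?_ hmK.le)
      rw [norm_mul]
      exact mul_le_one₀ hle (norm_nonneg _) hle1
    rw [h2, norm_mul] at h2K
    have := mul_le_of_le_one_right (norm_nonneg (1 + a)) hle2
    linarith
  · rw [← norm_neg]
    refine norm_eq_one_of_one_add_pow_eq (neg_ne_zero.mpr hb) hm hmK ?_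
    rw [hodd.neg_pow, ← h, show 1 + -(1 + a) = -a by ring, hodd.neg_pow]
    ring

theorem PadicAlgCl.norm_natCast_eq_one {p n : ℕ} [Fact p.Prime] (hn : 0 < n) (hlt : n < p) :
    ‖(n : PadicAlgCl p)‖ = 1 := by
  have h : ‖(n : PadicAlgCl p)‖ = ‖(n : ℚ_[p])‖ := by
    rw [← PadicAlgCl.norm_extends p, map_natCast]
  rw [h, Padic.norm_natCast_eq_one_iff]
  exact Nat.coprime_of_lt_prime hn.ne' hlt (Fact.out : p.Prime)

/-! ### Common complex roots -/

theorem isAlgebraic_of_one_add_pow_eq {a : ℂ} {m : ℕ} (hm : 2 ≤ m)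
    (h : 1 + a ^ m = (1 + a) ^ m) : IsAlgebraic ℚ a := by
  refine ⟨1 + Polynomial.X ^ m - (1 + Polynomial.X) ^ m, fun h0 => ?_, by simp [h]⟩
  have h1 := congrArg (Polynomial.eval 1) h0
  simp only [Polynomial.eval_sub, Polynomial.eval_add, Polynomial.eval_one, Polynomial.eval_pow,
    Polynomial.eval_X, one_pow, Polynomial.eval_zero] at h1
  norm_num at h1
  have : (2 : ℚ) ^ 2 ≤ 2 ^ m := pow_le_pow_right₀ one_le_two hm
  linarith

theorem exists_pow_eq_one_of_infinite {a : ℂ} (ha : a ≠ 0) (hb : 1 + a ≠ 0)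
    (hinf : {m : ℕ | 1 + a ^ m = (1 + a) ^ m}.Infinite) :
    ∃ M, 0 < M ∧ a ^ M = 1 ∧ (1 + a) ^ M = 1 := by
  obtain ⟨m, hm, hm2⟩ := hinf.exists_gt 1
  -- A prime above `m` and 2 makes both p-adic units; the single exponent `m` then shows that the
  -- images of `a` and `1 + a` are units.
  obtain ⟨p, hpm, hp⟩ := Nat.exists_infinite_primes (m + 3)
  have : Fact p.Prime := ⟨hp⟩
  let L := IntermediateField.adjoin ℚ ({a} : Set ℂ)
  have : FiniteDimensional ℚ L := IntermediateField.adjoin.finiteDimensional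
    (isAlgebraic_of_one_add_pow_eq hm2 hm).isIntegral
  let φ : L →ₐ[ℚ] PadicAlgCl p := IsAlgClosed.lift
  have hφ : Function.Injective φ := φ.toRingHom.injective
  let x : L := ⟨a, IntermediateField.mem_adjoin_simple_self ℚ a⟩
  have hx : ∀ k, 1 + a ^ k = (1 + a) ^ k ↔ 1 + φ x ^ k = (1 + φ x) ^ k := by
    intro k
    rw [← map_one φ, ← map_add, ← map_pow, ← map_pow, ← map_add, hφ.eq_iff]
    exact (Subtype.ext_iff (a1 := 1 + x ^ k) (a2 := (1 + x) ^ k)).symm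
  have hx0 : φ x ≠ 0 := fun h0 => ha (congrArg Subtype.val ((map_eq_zero φ).mp h0))
  have hx1 : 1 + φ x ≠ 0 := by
    rw [← map_one φ, ← map_add]
    exact fun h0 => hb (congrArg Subtype.val ((map_eq_zero φ).mp h0))
  have hmK : ‖(m : PadicAlgCl p)‖ = 1 :=
    PadicAlgCl.norm_natCast_eq_one (by omega) (by omega)
  have h2K : ‖(2 : PadicAlgCl p)‖ = 1 := by
    exact_mod_cast PadicAlgCl.norm_natCast_eq_one (p := p) (n := 2) (by omega) (by omega)
  obtain ⟨M, hM, h1, h2⟩ := PadicAlgCl.exists_pow_eq_one_of_infinite p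
    (norm_eq_one_of_one_add_pow_eq hx0 hm2 hmK ((hx m).mp hm))
    (norm_one_add_eq_one_of_one_add_pow_eq hx0 hx1 hm2 h2K hmK ((hx m).mp hm))
    (hinf.mono fun k hk => (hx k).mp hk)
  refine ⟨M, hM, ?_, ?_⟩
  · rw [← map_pow, ← map_one φ] at h1
    exact congrArg Subtype.val (hφ h1)
  · rw [← map_one φ, ← map_add, ← map_pow] at h2
    exact congrArg Subtype.val (hφ h2)

/-- A common zero of infinitely many of the polynomials `1 + y ^ m - (1 + y) ^ m`. -/
theorem eq_of_infinite_one_add_pow_eq {a : ℂ}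
    (hinf : {m : ℕ | 1 + a ^ m = (1 + a) ^ m}.Infinite) :
    a = 0 ∨ a = -1 ∨ 1 + a + a ^ 2 = 0 := by
  by_cases ha : a = 0
  · exact Or.inl ha
  by_cases hb : 1 + a = 0
  · exact Or.inr (Or.inl (by linear_combination hb))
  refine Or.inr (Or.inr ?_)
  obtain ⟨M, hM, h1, h2⟩ := exists_pow_eq_one_of_infinite ha hb hinf
  have n1 := Complex.norm_eq_one_of_pow_eq_one h1 hM.ne'
  -- The unit circles about `0` and `-1` meet only at the primitive cube roots of unity.
  have n2 := Complex.norm_eq_one_of_pow_eq_one h2 hM.ne'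
  have s1 : a.re * a.re + a.im * a.im = 1 := by
    rw [← Complex.normSq_apply, Complex.normSq_eq_norm_sq, n1, one_pow]
  have s2 : (1 + a.re) * (1 + a.re) + a.im * a.im = 1 := by
    have := Complex.normSq_apply (1 + a)
    rw [Complex.normSq_eq_norm_sq, n2, one_pow] at this
    simpa using this.symm
  have hre : a.re = -1 / 2 := by linarith
  apply Complex.ext
  · simp only [pow_two, Complex.add_re, Complex.mul_re, Complex.one_re, Complex.zero_re]
    rw [hre] at s1 ⊢
    linarith
  · simp only [pow_two, Complex.add_im, Complex.mul_im, Complex.one_im, Complex.zero_im]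
    rw [hre]
    ring

/-! ### Divisors of forms -/

-- Scaling every variable by a new variable `T` records the grading as powers of `T`.
open MvPolynomial in
theorem MvPolynomial.coeff_aeval_C_X_mul_X {σ : Type*} (F : MvPolynomial σ ℂ) (k : ℕ) :
    (aeval (fun i => Polynomial.C (X i) * Polynomial.X : σ → Polynomial (MvPolynomial σ ℂ))
      F).coeff k = homogeneousComponent k F := by
  induction F using MvPolynomial.induction_on' with
  | add p q hp hq => rw [map_add, Polynomial.coeff_add, hp, hq, map_add]
  | monomial d c =>
    have h : aeval (fun i => Polynomial.C (X i) * Polynomial.X : σ → Polynomial (MvPolynomial σ ℂ))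
        (monomial d c) = Polynomial.C (monomial d c) * Polynomial.X ^ d.degree := by
      rw [aeval_monomial, monomial_eq, Finsupp.prod, Finsupp.prod, Finsupp.degree_apply,
        ← Finset.prod_pow_eq_pow_sum, map_mul, map_prod, mul_assoc, ← Finset.prod_mul_distrib]
      simp only [map_pow, mul_pow]
      rfl
    rw [h, Polynomial.coeff_C_mul_X_pow]
    split_ifs with hk
    · exact (homogeneousComponent_eq_self (isHomogeneous_monomial c hk.symm)).symm
    · exact (homogeneousComponent_of_mem (isHomogeneous_monomial c rfl)).trans (if_neg hk) |>.symm

open MvPolynomial in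
/-- A divisor of a nonzero homogeneous polynomial is homogeneous. -/
theorem MvPolynomial.IsHomogeneous.exists_of_dvd {σ : Type*} {F G : MvPolynomial σ ℂ} {n : ℕ}
    (hG : G.IsHomogeneous n) (hG0 : G ≠ 0) (h : F ∣ G) : ∃ k, F.IsHomogeneous k := by
  obtain ⟨Q, rfl⟩ := h
  have hF0 : F ≠ 0 := left_ne_zero_of_mul hG0
  have hQ0 : Q ≠ 0 := right_ne_zero_of_mul hG0
  let φ : MvPolynomial σ ℂ →ₐ[ℂ] Polynomial (MvPolynomial σ ℂ) :=
    MvPolynomial.aeval (fun i => Polynomial.C (X i) * Polynomial.X)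
  have hφ : ∀ P k, (φ P).coeff k = homogeneousComponent k P := coeff_aeval_C_X_mul_X
  have hφ0 : ∀ P, P ≠ 0 → φ P ≠ 0 := by
    intro P hP h0
    refine hP ?_
    rw [← sum_homogeneousComponent P]
    exact Finset.sum_eq_zero fun k _ => by rw [← hφ, h0, Polynomial.coeff_zero]
  have hmon : φ (F * Q) = Polynomial.monomial n (F * Q) := by
    ext1 k
    rw [hφ, Polynomial.coeff_monomial, homogeneousComponent_of_mem hG]
    simp only [eq_comm]
  -- The product is a monomial in `T`. Its degree and trailing degree are both additive and equal to
  -- `n`, so they agree for each factor.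
  have hdeg : (φ F).natDegree + (φ Q).natDegree = n := by
    rw [← Polynomial.natDegree_mul (hφ0 F hF0) (hφ0 Q hQ0), ← map_mul, hmon,
      Polynomial.natDegree_monomial_eq _ hG0]
  have htrail : (φ F).natTrailingDegree + (φ Q).natTrailingDegree = n := by
    rw [← Polynomial.natTrailingDegree_mul (hφ0 F hF0) (hφ0 Q hQ0), ← map_mul, hmon,
      Polynomial.natTrailingDegree_monomial hG0]
  have h1 := (φ F).natTrailingDegree_le_natDegree
  have h2 := (φ Q).natTrailingDegree_le_natDegree
  have hcomp : ∀ k, k ≠ (φ F).natDegree → homogeneousComponent k F = 0 := by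
    intro k hk
    rw [← hφ]
    rcases lt_or_gt_of_ne hk with hlt | hgt
    · exact Polynomial.coeff_eq_zero_of_lt_natTrailingDegree (by omega)
    · exact Polynomial.coeff_eq_zero_of_natDegree_lt hgt
  clear_value φ
  generalize (φ F).natDegree = d at hcomp
  have hsum :
      (∑ k ∈ Finset.range (F.totalDegree + 1), homogeneousComponent k F).IsHomogeneous d := by
    refine IsHomogeneous.sum _ _ _ fun k _ => ?_
    by_cases hk : k = d
    · rw [hk]
      exact homogeneousComponent_isHomogeneous _ _
    · rw [hcomp k hk]
      exact isHomogeneous_zero _ _ _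
  rw [sum_homogeneousComponent] at hsum
  exact ⟨d, hsum⟩

/-! ### Symmetric forms and their values at `(1, y)` -/

/-- The interchange of `x₁` and `x₂`. -/
noncomputable def swapXX : MvPolynomial (Fin 2 ⊕ Fin 0) ℂ →ₐ[ℂ] MvPolynomial (Fin 2 ⊕ Fin 0) ℂ :=
  MvPolynomial.rename (Sum.map (Equiv.swap (0 : Fin 2) 1) (1 : Equiv.Perm (Fin 0)))

theorem swapXX_x₁ : swapXX x₁ = x₂ := by
  simp [swapXX, x₁, x₂]

theorem swapXX_x₂ : swapXX x₂ = x₁ := by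
  simp [swapXX, x₁, x₂]

theorem swapXX_C (c : ℂ) : swapXX (MvPolynomial.C c) = MvPolynomial.C c := by
  simp [swapXX]

theorem isProper_iff_swapXX {H : MvPolynomial (Fin 2 ⊕ Fin 0) ℂ} :
    IsProper H ↔ swapXX H = H := by
  refine ⟨fun h => h _ _, fun h σ τ => ?_⟩
  have hτ : τ = 1 := Subsingleton.elim _ _
  have hσ : σ = 1 ∨ σ = Equiv.swap 0 1 := by
    revert σ
    decide
  rcases hσ with rfl | rfl
  · rw [hτ]
    convert MvPolynomial.rename_id_apply H
    ext x
    rcases x with x | x <;> simp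
  · rw [hτ]
    exact h

theorem atOne_x₁ : atOne x₁ = 1 := by simp [atOne, x₁]

theorem atOne_x₂ : atOne x₂ = Polynomial.X := by simp [atOne, x₂]

theorem atOne_C (c : ℂ) : atOne (MvPolynomial.C c) = Polynomial.C c := by
  simp [atOne]

theorem isHomogeneous_x₁ : x₁.IsHomogeneous 1 := MvPolynomial.isHomogeneous_X _ _

theorem isHomogeneous_x₂ : x₂.IsHomogeneous 1 := MvPolynomial.isHomogeneous_X _ _

theorem natDegree_atOne_le {H : MvPolynomial (Fin 2 ⊕ Fin 0) ℂ} {n : ℕ}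
    (hH : H.IsHomogeneous n) : (atOne H).natDegree ≤ n := by
  have := MvPolynomial.aeval_natDegree_le (m := n) (n := 1) H hH.totalDegree_le
    (Sum.elim ![1, Polynomial.X] Fin.elim0) fun i => ?_
  · simpa [atOne] using this
  · rcases i with i | i
    · fin_cases i <;> simp
    · exact i.elim0

/-- The homogeneous polynomial `x₁ ^ n * q(x₂ / x₁)`. -/
noncomputable def homogenizeXX (q : Polynomial ℂ) (n : ℕ) : MvPolynomial (Fin 2 ⊕ Fin 0) ℂ :=
  MvPolynomial.rename ![Sum.inl 1, Sum.inl 0] (q.homogenize n)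

theorem isHomogeneous_homogenizeXX (q : Polynomial ℂ) (n : ℕ) :
    (homogenizeXX q n).IsHomogeneous n :=
  (Polynomial.isHomogeneous_homogenize q).rename_isHomogeneous

theorem atOne_homogenizeXX {q : Polynomial ℂ} {n : ℕ} (hq : q.natDegree ≤ n) :
    atOne (homogenizeXX q n) = q := by
  rw [atOne, homogenizeXX, MvPolynomial.aeval_rename,
    Polynomial.aeval_homogenize_of_eq_one hq _ (by simp)]
  simp

theorem homogenizeXX_atOne {H : MvPolynomial (Fin 2 ⊕ Fin 0) ℂ} {n : ℕ}
    (hH : H.IsHomogeneous n) : homogenizeXX (atOne H) n = H := by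
  let s : Fin 2 ⊕ Fin 0 → Fin 2 := Sum.elim ![1, 0] Fin.elim0
  have h : (atOne H).homogenize n = MvPolynomial.rename s H := by
    refine Polynomial.homogenize_eq_of_isHomogeneous hH.rename_isHomogeneous ?_
    rw [MvPolynomial.aeval_rename, atOne]
    congr 2
    ext1 i
    rcases i with i | i
    · fin_cases i <;> simp [s]
    · exact i.elim0
  rw [homogenizeXX, h, MvPolynomial.rename_rename]
  convert MvPolynomial.rename_id_apply H
  ext1 i
  rcases i with i | i
  · fin_cases i <;> simp [s]
  · exact i.elim0

theorem MvPolynomial.IsHomogeneous.eq_of_atOne_eq {H G : MvPolynomial (Fin 2 ⊕ Fin 0) ℂ} {n : ℕ}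
    (hH : H.IsHomogeneous n) (hG : G.IsHomogeneous n) (h : atOne H = atOne G) : H = G := by
  rw [← homogenizeXX_atOne hH, h, homogenizeXX_atOne hG]

/-- Setting `x₁ = 1` only loses powers of `x₁`, so `H * A = x₁ ^ N * G`. Interchanging the variables
and comparing gives `x₁ ^ N ∣ A * x₂ ^ N`, and the power of `x₁` cancels. -/
theorem dvd_of_atOne_dvd {H G : MvPolynomial (Fin 2 ⊕ Fin 0) ℂ} {n m : ℕ}
    (hH : H.IsHomogeneous n) (hG : G.IsHomogeneous m) (hHs : swapXX H = H) (hGs : swapXX G = G)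
    (hH0 : H ≠ 0) (h : atOne H ∣ atOne G) : H ∣ G := by
  obtain ⟨q, hq⟩ := h
  -- The factor `x₁ ^ m` and the exponent `N` equalize the degrees of `H * A` and `x₁ ^ N * G`.
  set A := x₁ ^ m * homogenizeXX q q.natDegree with hA
  set N := n + q.natDegree with hN
  have hAG : H * A = x₁ ^ N * G := by
    have h1 : (H * A).IsHomogeneous (n + (1 * m + q.natDegree)) :=
      hH.mul ((isHomogeneous_x₁.pow m).mul (isHomogeneous_homogenizeXX _ _))
    have h2 : (x₁ ^ N * G).IsHomogeneous (1 * N + m) := (isHomogeneous_x₁.pow N).mul hG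
    rw [show n + (1 * m + q.natDegree) = 1 * N + m by rw [hN]; ring] at h1
    refine h1.eq_of_atOne_eq h2 ?_
    rw [hA, map_mul, map_mul, map_mul, map_pow, map_pow, atOne_x₁, atOne_homogenizeXX le_rfl, hq,
      one_pow, one_pow, one_mul, one_mul]
  have hAG' : H * swapXX A = x₂ ^ N * G := by
    have := congrArg swapXX hAG
    rwa [map_mul swapXX H, map_mul swapXX (x₁ ^ N), map_pow, swapXX_x₁, hHs, hGs] at this
  have hAA : A * x₂ ^ N = x₁ ^ N * swapXX A := by
    refine mul_left_cancel₀ hH0 ?_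
    linear_combination x₂ ^ N * hAG - x₁ ^ N * hAG'
  have hx : ¬ x₁ ∣ x₂ ^ N := fun hd => by
    have := (MvPolynomial.X_prime (R := ℂ) (i := (Sum.inl 0 : Fin 2 ⊕ Fin 0))).dvd_of_dvd_pow hd
    rw [x₂, MvPolynomial.X_dvd_X] at this
    simp at this
  obtain ⟨B, hB⟩ := (MvPolynomial.X_prime (R := ℂ)
    (i := (Sum.inl 0 : Fin 2 ⊕ Fin 0))).pow_dvd_of_dvd_mul_right N hx ⟨_, hAA⟩
  change A = x₁ ^ N * B at hB
  refine ⟨B, mul_left_cancel₀ (pow_ne_zero N (MvPolynomial.X_ne_zero _) : x₁ ^ N ≠ 0) ?_⟩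
  rw [← hAG, hB]
  ring

theorem eq_of_atOne_eq {H G : MvPolynomial (Fin 2 ⊕ Fin 0) ℂ} {n m : ℕ}
    (hH : H.IsHomogeneous n) (hG : G.IsHomogeneous m) (hHs : swapXX H = H) (hGs : swapXX G = G)
    (hH0 : H ≠ 0) (hG0 : G ≠ 0) (h : atOne H = atOne G) : H = G := by
  have h1 := MvPolynomial.totalDegree_le_of_dvd_of_isDomain
    (dvd_of_atOne_dvd hH hG hHs hGs hH0 h.dvd) hG0
  have h2 := MvPolynomial.totalDegree_le_of_dvd_of_isDomain
    (dvd_of_atOne_dvd hG hH hGs hHs hG0 h.symm.dvd) hH0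
  rw [hH.totalDegree hH0, hG.totalDegree hG0] at h1 h2
  obtain rfl := le_antisymm h1 h2
  exact hH.eq_of_atOne_eq hG h

theorem atOne_ne_zero {H : MvPolynomial (Fin 2 ⊕ Fin 0) ℂ} {n : ℕ} (hH : H.IsHomogeneous n)
    (hH0 : H ≠ 0) : atOne H ≠ 0 := fun h =>
  hH0 (hH.eq_of_atOne_eq (MvPolynomial.isHomogeneous_zero _ _ _) (h.trans (map_zero _).symm))

/-- The interchange sends `x₂ - z x₁` to `x₁ - z x₂`, which at `(1, y)` is `-z (y - z⁻¹)`. -/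
theorem X_sub_C_inv_pow_dvd_atOne {H : MvPolynomial (Fin 2 ⊕ Fin 0) ℂ} {n : ℕ}
    (hH : H.IsHomogeneous n) (hHs : swapXX H = H) (hH0 : H ≠ 0) {z : ℂ} (hz : z ≠ 0) {k : ℕ}
    (h : (Polynomial.X - Polynomial.C z) ^ k ∣ atOne H) :
    (Polynomial.X - Polynomial.C z⁻¹) ^ k ∣ atOne H := by
  obtain ⟨q, hq⟩ := h
  have h0 := atOne_ne_zero hH hH0
  have hdeg := natDegree_atOne_le hH
  rw [hq] at h0
  rw [hq, Polynomial.natDegree_mul (left_ne_zero_of_mul h0) (right_ne_zero_of_mul h0),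
    Polynomial.natDegree_pow, Polynomial.natDegree_X_sub_C, mul_one] at hdeg
  have hL : (x₂ - MvPolynomial.C z * x₁).IsHomogeneous 1 :=
    isHomogeneous_x₂.sub (isHomogeneous_x₁.C_mul z)
  have hfac : H = (x₂ - MvPolynomial.C z * x₁) ^ k * homogenizeXX q (n - k) := by
    have h1 := (hL.pow k).mul (isHomogeneous_homogenizeXX q (n - k))
    rw [show 1 * k + (n - k) = n by omega] at h1
    refine hH.eq_of_atOne_eq h1 ?_
    rw [map_mul, map_pow, map_sub, map_mul, atOne_x₁, atOne_x₂, atOne_C,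
      atOne_homogenizeXX (by omega), mul_one, hq]
  have hsw : atOne H = (1 - Polynomial.C z * Polynomial.X) ^ k *
      atOne (swapXX (homogenizeXX q (n - k))) := by
    rw [← hHs]
    nth_rewrite 1 [hfac]
    simp only [map_mul, map_pow, map_sub, swapXX_x₁, swapXX_x₂, swapXX_C, atOne_x₁, atOne_x₂,
      atOne_C]
  rw [hsw]
  refine Dvd.dvd.mul_right (pow_dvd_pow_of_dvd ⟨Polynomial.C (-z), ?_⟩ k) _
  have : Polynomial.C z⁻¹ * Polynomial.C z = 1 := by
    rw [← Polynomial.C_mul, inv_mul_cancel₀ hz, Polynomial.C_1]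
  rw [Polynomial.C_neg]
  linear_combination -this

/-! ### Roots and multiplicities of `addPowDefect m` -/

/-- The polynomial `1 + y ^ m - (1 + y) ^ m`. -/
noncomputable def addPowDefect (m : ℕ) : Polynomial ℂ :=
  1 + Polynomial.X ^ m - (1 + Polynomial.X) ^ m

theorem eval_addPowDefect (m : ℕ) (z : ℂ) :
    (addPowDefect m).eval z = 1 + z ^ m - (1 + z) ^ m := by
  simp [addPowDefect]

theorem eval_derivative_addPowDefect (m : ℕ) (z : ℂ) :
    (addPowDefect m).derivative.eval z = m * (z ^ (m - 1) - (1 + z) ^ (m - 1)) := by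
  simp [addPowDefect, Polynomial.derivative_pow]
  ring

theorem eval_derivative_derivative_addPowDefect (m : ℕ) (z : ℂ) :
    (addPowDefect (m + 2)).derivative.derivative.eval z =
      (m + 2) * (m + 1) * (z ^ m - (1 + z) ^ m) := by
  simp [addPowDefect, Polynomial.derivative_pow]
  ring

theorem addPowDefect_ne_zero {m : ℕ} (hm : m ≠ 1) : addPowDefect m ≠ 0 := by
  intro h
  have h1 := eval_addPowDefect m 1
  rw [h, Polynomial.eval_zero, one_pow, one_add_one_eq_two] at h1
  have h2 : (2 : ℂ) ^ m = 2 ^ 1 := by linear_combination h1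
  exact hm (Nat.pow_right_injective le_rfl (by exact_mod_cast h2))

theorem eval_zero_addPowDefect_eq_zero_iff {m : ℕ} (hm : m ≠ 1) :
    (addPowDefect m).eval 0 = 0 ↔ 1 < m := by
  rw [eval_addPowDefect, add_zero, one_pow, add_sub_cancel_left]
  rcases eq_or_ne m 0 with rfl | h0
  · simp
  · simp only [zero_pow h0, true_iff]
    omega

theorem eval_neg_one_addPowDefect_eq_zero_iff {m : ℕ} :
    (addPowDefect m).eval (-1) = 0 ↔ m ≡ 1 [MOD 2] := by
  rw [eval_addPowDefect, add_neg_cancel, Nat.ModEq]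
  rcases m.even_or_odd with h | h
  · have h2 : m % 2 = 0 := Nat.even_iff.mp h
    rw [h.neg_one_pow, h2]
    rcases eq_or_ne m 0 with rfl | h0
    · norm_num
    · norm_num [zero_pow h0]
  · have h2 : m % 2 = 1 := Nat.odd_iff.mp h
    have h0 : m ≠ 0 := by rintro rfl; simp at h
    rw [h.neg_one_pow, h2, zero_pow h0]
    norm_num

/-- Here `z` is a primitive cube root of unity and `1 + z = -z²` a primitive sixth root, whence the
period 6. -/
theorem eval_addPowDefect_add {z : ℂ} (hz : 1 + z + z ^ 2 = 0) (k r : ℕ) :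
    (addPowDefect (6 * k + r)).eval z = (addPowDefect r).eval z := by
  have h1 : z ^ 6 = 1 := by linear_combination (z - 1) * (z ^ 3 + 1) * hz
  have h2 : (1 + z) ^ 6 = 1 := by
    rw [show 1 + z = -z ^ 2 by linear_combination hz]
    linear_combination (z ^ 6 + 1) * h1
  rw [eval_addPowDefect, eval_addPowDefect, pow_add, pow_add, pow_mul, pow_mul, h1, h2, one_pow,
    one_mul, one_mul]

theorem eval_derivative_addPowDefect_add {z : ℂ} (hz : 1 + z + z ^ 2 = 0) (k r : ℕ) :
    (addPowDefect (6 * k + (r + 1))).derivative.eval z =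
      ((6 * k + (r + 1) : ℕ) : ℂ) * (z ^ r - (1 + z) ^ r) := by
  have h1 : z ^ 6 = 1 := by linear_combination (z - 1) * (z ^ 3 + 1) * hz
  have h2 : (1 + z) ^ 6 = 1 := by
    rw [show 1 + z = -z ^ 2 by linear_combination hz]
    linear_combination (z ^ 6 + 1) * h1
  rw [eval_derivative_addPowDefect, show 6 * k + (r + 1) - 1 = 6 * k + r by omega, pow_add,
    pow_add, pow_mul, pow_mul, h1, h2, one_pow, one_mul, one_mul]

theorem ne_zero_of_one_add_add_sq {z : ℂ} (hz : 1 + z + z ^ 2 = 0) : z ≠ 0 := by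
  rintro rfl
  norm_num at hz

theorem eval_addPowDefect_eq_zero_iff {z : ℂ} (hz : 1 + z + z ^ 2 = 0) {m : ℕ} :
    (addPowDefect m).eval z = 0 ↔ m ≡ 1 [MOD 6] ∨ m ≡ 5 [MOD 6] := by
  have hz0 := ne_zero_of_one_add_add_sq hz
  have hz1 : 1 + z ≠ 0 := by
    rw [show 1 + z = -z ^ 2 by linear_combination hz]
    exact neg_ne_zero.mpr (pow_ne_zero 2 hz0)
  have hm := Nat.div_add_mod m 6
  have hlt := Nat.mod_lt m (show 0 < 6 by norm_num)
  rw [Nat.ModEq, Nat.ModEq]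
  conv_lhs => rw [← hm, eval_addPowDefect_add hz, eval_addPowDefect]
  generalize m % 6 = r at hlt
  interval_cases r
  · norm_num
  · norm_num
  · norm_num
    rw [show 1 + z ^ 2 - (1 + z) ^ 2 = -2 * z by ring]
    exact mul_ne_zero (by norm_num) hz0
  · norm_num
    rw [show 1 + z ^ 3 - (1 + z) ^ 3 = -3 * z * (1 + z) by ring]
    exact mul_ne_zero (mul_ne_zero (by norm_num) hz0) hz1
  · norm_num
    rw [show 1 + z ^ 4 - (1 + z) ^ 4 = 2 * (1 + z) by
      linear_combination (-4 * z - 2) * hz]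
    exact mul_ne_zero (by norm_num) hz1
  · norm_num
    linear_combination (-5 * z * (1 + z)) * hz

/-- The derivative separates the two residues: it vanishes for residue 1, while for residue 5 it is
`m (z^4 - (1+z)^4) = m (2z + 1) ≠ 0`. -/
theorem eval_derivative_addPowDefect_eq_zero_iff {z : ℂ} (hz : 1 + z + z ^ 2 = 0) {m : ℕ} :
    ((addPowDefect m).eval z = 0 ∧ (addPowDefect m).derivative.eval z = 0) ↔ m ≡ 1 [MOD 6] := by
  have hz0 := ne_zero_of_one_add_add_sq hz
  rw [eval_addPowDefect_eq_zero_iff hz, Nat.ModEq, Nat.ModEq]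
  have hm := Nat.div_add_mod m 6
  constructor
  · rintro ⟨h1 | h5, hd⟩
    · exact h1
    · exfalso
      rw [h5] at hm
      rw [← hm, eval_derivative_addPowDefect_add hz _ 4] at hd
      rcases mul_eq_zero.mp hd with h | h
      · exact absurd h (Nat.cast_ne_zero.mpr (by omega))
      · have h3 : 2 * z + 1 = 0 := by
          linear_combination h + (4 * z + 2) * hz
        have h4 : (3 : ℂ) = 0 := by linear_combination 4 * hz - (2 * z + 1) * h3
        norm_num at h4
  · intro h1
    refine ⟨Or.inl h1, ?_⟩
    rw [h1] at hm
    rw [← hm, eval_derivative_addPowDefect_add hz _ 0]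
    simp

theorem rootMultiplicity_zero_addPowDefect_le {m : ℕ} (hm : m ≠ 1) :
    (addPowDefect m).rootMultiplicity 0 ≤ 1 := by
  by_contra! h
  obtain ⟨h0, h1⟩ :=
    (Polynomial.one_lt_rootMultiplicity_iff_isRoot (addPowDefect_ne_zero hm)).mp h
  have hm1 := (eval_zero_addPowDefect_eq_zero_iff hm).mp h0
  rw [Polynomial.IsRoot, eval_derivative_addPowDefect, zero_pow (by omega)] at h1
  simp at h1
  omega

theorem rootMultiplicity_neg_one_addPowDefect_le {m : ℕ} (hm : m ≠ 1) :
    (addPowDefect m).rootMultiplicity (-1) ≤ 1 := by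
  by_contra! h
  obtain ⟨h0, h1⟩ :=
    (Polynomial.one_lt_rootMultiplicity_iff_isRoot (addPowDefect_ne_zero hm)).mp h
  have hm1 := eval_neg_one_addPowDefect_eq_zero_iff.mp h0
  rw [Nat.ModEq] at hm1
  rw [Polynomial.IsRoot, eval_derivative_addPowDefect, add_neg_cancel,
    zero_pow (by omega : m - 1 ≠ 0), sub_zero] at h1
  simp at h1
  omega

/-- A triple root needs `m ≡ 1` modulo 6. Then `m - 2 ≡ 5`, so `z^(m-2) - (1+z)^(m-2) = -1` and the
second derivative is nonzero. -/
theorem rootMultiplicity_addPowDefect_le {z : ℂ} (hz : 1 + z + z ^ 2 = 0) {m : ℕ} (hm : m ≠ 1) :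
    (addPowDefect m).rootMultiplicity z ≤ 2 := by
  by_contra! h
  have h0 := Polynomial.isRoot_iterate_derivative_of_lt_rootMultiplicity
    (pos_of_gt h)
  have h1 := Polynomial.isRoot_iterate_derivative_of_lt_rootMultiplicity
    (lt_trans one_lt_two h)
  have h2 := Polynomial.isRoot_iterate_derivative_of_lt_rootMultiplicity h
  have hm1 := (eval_derivative_addPowDefect_eq_zero_iff hz).mp ⟨h0, h1⟩
  rw [Nat.ModEq] at hm1
  obtain ⟨k, rfl⟩ := Nat.exists_eq_add_of_le' (show 2 ≤ m by omega)
  have h3 : (addPowDefect (k + 2)).derivative.derivative.eval z = 0 := h2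
  rw [eval_derivative_derivative_addPowDefect] at h3
  have hk : ((k : ℂ) + 2) * (k + 1) ≠ 0 := by exact_mod_cast (by positivity : (k + 2) * (k + 1) ≠ 0)
  have h4 := (mul_eq_zero.mp h3).resolve_left hk
  have h5 := (eval_addPowDefect_eq_zero_iff hz (m := k)).mpr (Or.inr (by rw [Nat.ModEq]; omega))
  rw [eval_addPowDefect] at h5
  have : (1 : ℂ) = 0 := by linear_combination h5 - h4
  exact one_ne_zero this

theorem exists_one_add_add_sq : ∃ z w : ℂ, z ≠ w ∧ 1 + z + z ^ 2 = 0 ∧ 1 + w + w ^ 2 = 0 ∧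
    z⁻¹ = w ∧ w⁻¹ = z ∧ (∀ x : ℂ, 1 + x + x ^ 2 = 0 → x = z ∨ x = w) ∧
    1 + Polynomial.X + Polynomial.X ^ 2 =
      (Polynomial.X - Polynomial.C z) * (Polynomial.X - Polynomial.C w) := by
  obtain ⟨s, hs⟩ := IsAlgClosed.exists_pow_nat_eq (-3 : ℂ) (n := 2) (by norm_num)
  have hs0 : s ≠ 0 := by rintro rfl; norm_num at hs
  have hsum : (-1 + s) / 2 + (-1 - s) / 2 = -1 := by ring
  have hmul : (-1 + s) / 2 * ((-1 - s) / 2) = 1 := by linear_combination -hs / 4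
  refine ⟨(-1 + s) / 2, (-1 - s) / 2, fun h => hs0 (by linear_combination h), ?_, ?_,
    inv_eq_of_mul_eq_one_right hmul, inv_eq_of_mul_eq_one_left hmul, fun x hx => ?_, ?_⟩
  · linear_combination hs / 4
  · linear_combination hs / 4
  · have : (x - (-1 + s) / 2) * (x - (-1 - s) / 2) = 0 := by linear_combination hx - hs / 4
    rcases mul_eq_zero.mp this with h | h
    · exact Or.inl (sub_eq_zero.mp h)
    · exact Or.inr (sub_eq_zero.mp h)
  · generalize (-1 + s) / 2 = z at *
    generalize (-1 - s) / 2 = w at *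
    have h1 : Polynomial.C z + Polynomial.C w = -1 := by
      rw [← Polynomial.C_add, hsum, Polynomial.C_neg, Polynomial.C_1]
    have h2 : Polynomial.C z * Polynomial.C w = 1 := by
      rw [← Polynomial.C_mul, hmul, Polynomial.C_1]
    linear_combination -h2 + Polynomial.X * h1

theorem X_sub_C_pow_dvd_addPowDefect_iff {z : ℂ} (hz : 1 + z + z ^ 2 = 0) {m : ℕ} (hm : m ≠ 1)
    {γ : ℕ} (hγ : γ ≤ 2) : (Polynomial.X - Polynomial.C z) ^ γ ∣ addPowDefect m ↔
      (γ = 1 → m ≡ 1 [MOD 6] ∨ m ≡ 5 [MOD 6]) ∧ (γ = 2 → m ≡ 1 [MOD 6]) := by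
  rw [← Polynomial.le_rootMultiplicity_iff (addPowDefect_ne_zero hm)]
  interval_cases γ
  · simp
  · rw [Nat.one_le_iff_ne_zero, ← pos_iff_ne_zero,
      Polynomial.rootMultiplicity_pos (addPowDefect_ne_zero hm), Polynomial.IsRoot,
      eval_addPowDefect_eq_zero_iff hz]
    simp
  · rw [← Nat.lt_iff_add_one_le (m := 1),
      Polynomial.one_lt_rootMultiplicity_iff_isRoot (addPowDefect_ne_zero hm),
      Polynomial.IsRoot, Polynomial.IsRoot, eval_derivative_addPowDefect_eq_zero_iff hz]
    simp

theorem IsCoprime.mul_dvd_iff' {R : Type*} [CommRing R] {a b c : R} (h : IsCoprime a b) :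
    a * b ∣ c ↔ a ∣ c ∧ b ∣ c :=
  ⟨fun hd => ⟨dvd_of_mul_right_dvd hd, dvd_of_mul_left_dvd hd⟩, fun hd => h.mul_dvd hd.1 hd.2⟩

/-- The factors are pairwise coprime, so each contributes its condition independently. -/
theorem prodY_dvd_addPowDefect_iff {α β γ : ℕ} (hα : α ≤ 1) (hβ : β ≤ 1) (hγ : γ ≤ 2) {m : ℕ}
    (hm : m ≠ 1) : prodY α β γ ∣ addPowDefect m ↔ OrderCond α β γ m := by
  obtain ⟨z, w, hzw, hz, hw, -, -, -, hfac⟩ := exists_one_add_add_sq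
  have c1 : IsCoprime (Polynomial.X : Polynomial ℂ) (1 + Polynomial.X) := ⟨-1, 1, by ring⟩
  have c2 : IsCoprime (Polynomial.X : Polynomial ℂ) (1 + Polynomial.X + Polynomial.X ^ 2) :=
    ⟨-1 - Polynomial.X, 1, by ring⟩
  have c3 : IsCoprime (1 + Polynomial.X : Polynomial ℂ)
      (1 + Polynomial.X + Polynomial.X ^ 2) := ⟨-Polynomial.X, 1, by ring⟩
  have c4 := Polynomial.isCoprime_X_sub_C_of_isUnit_sub (sub_ne_zero.mpr hzw).isUnit
  rw [prodY, IsCoprime.mul_dvd_iff' ((c2.pow).mul_left c3.pow), IsCoprime.mul_dvd_iff' c1.pow,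
    hfac, mul_pow, IsCoprime.mul_dvd_iff' c4.pow, X_sub_C_pow_dvd_addPowDefect_iff hz hm hγ,
    X_sub_C_pow_dvd_addPowDefect_iff hw hm hγ, and_self, OrderCond, and_assoc]
  refine and_congr ?_ (and_congr_left' ?_)
  · interval_cases α
    · simp
    · rw [pow_one, ← sub_zero Polynomial.X, ← Polynomial.C_0, Polynomial.dvd_iff_isRoot,
        Polynomial.IsRoot, eval_zero_addPowDefect_eq_zero_iff hm]
      simp
  · interval_cases β
    · simp
    · rw [pow_one, show (1 + Polynomial.X : Polynomial ℂ) = Polynomial.X - Polynomial.C (-1) by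
        rw [Polynomial.C_neg, Polynomial.C_1]; ring, Polynomial.dvd_iff_isRoot,
        Polynomial.IsRoot, eval_neg_one_addPowDefect_eq_zero_iff]
      simp

theorem eq_C_mul_prodY {h : Polynomial ℂ} {z w : ℂ} (hzw : z ≠ w) (hz : 1 + z + z ^ 2 = 0)
    (hw : 1 + w + w ^ 2 = 0) (hfac : 1 + Polynomial.X + Polynomial.X ^ 2 =
      (Polynomial.X - Polynomial.C z) * (Polynomial.X - Polynomial.C w))
    (hroots : ∀ x, h.IsRoot x → x = 0 ∨ x = -1 ∨ x = z ∨ x = w)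
    (hmul : h.rootMultiplicity z = h.rootMultiplicity w) :
    h = Polynomial.C h.leadingCoeff *
      prodY (h.rootMultiplicity 0) (h.rootMultiplicity (-1)) (h.rootMultiplicity z) := by
  have hz0 := ne_zero_of_one_add_add_sq hz
  have hw0 := ne_zero_of_one_add_add_sq hw
  have hz1 : z ≠ -1 := by rintro rfl; norm_num at hz
  have hw1 : w ≠ -1 := by rintro rfl; norm_num at hw
  have hsub : h.roots.toFinset ⊆ {0, -1, z, w} := by
    intro x hx
    have := hroots x (Polynomial.isRoot_of_mem_roots (Multiset.mem_toFinset.mp hx))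
    simpa using this
  have hprod : (h.roots.map fun a => Polynomial.X - Polynomial.C a).prod =
      ∏ a ∈ ({0, -1, z, w} : Finset ℂ),
        (Polynomial.X - Polynomial.C a) ^ h.rootMultiplicity a := by
    rw [Polynomial.prod_multiset_root_eq_finset_root]
    refine Finset.prod_subset hsub fun x _ hx => ?_
    rw [Multiset.mem_toFinset, ← Multiset.count_eq_zero, Polynomial.count_roots] at hx
    rw [hx, pow_zero]
  conv_lhs => rw [(IsAlgClosed.splits h).eq_prod_roots, hprod]
  rw [Finset.prod_insert (by simp [hz0.symm, hw0.symm]),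
    Finset.prod_insert (by simp [hz1.symm, hw1.symm]), Finset.prod_insert (by simpa using hzw),
    Finset.prod_singleton, ← hmul, prodY, hfac, mul_pow, Polynomial.C_0, sub_zero, Polynomial.C_neg,
    Polynomial.C_1, sub_neg_eq_add, add_comm Polynomial.X 1]
  ring

/-! ### Orders and classification of the proper divisors -/

theorem gFun_two_zero (m : ℕ) (c d : ℂ) :
    gFun 2 0 m c d = MvPolynomial.C c * (x₁ ^ m + x₂ ^ m - (x₁ + x₂) ^ m) := by
  simp only [gFun, x₁, x₂, Fin.sum_univ_two, Finset.univ_eq_empty, Finset.sum_empty, mul_zero,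
    add_zero]
  ring

theorem atOne_gFun (m : ℕ) (c d : ℂ) :
    atOne (gFun 2 0 m c d) = Polynomial.C c * addPowDefect m := by
  simp only [gFun_two_zero, map_mul, map_sub, map_add, map_pow, atOne_x₁, atOne_x₂, atOne_C,
    one_pow, addPowDefect]

theorem isHomogeneous_gFun (m : ℕ) (c d : ℂ) : (gFun 2 0 m c d).IsHomogeneous m := by
  rw [gFun_two_zero]
  have h1 := isHomogeneous_x₁.pow m
  have h2 := isHomogeneous_x₂.pow m
  have h3 := (isHomogeneous_x₁.add isHomogeneous_x₂).pow m
  rw [one_mul] at h1 h2 h3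
  exact ((h1.add h2).sub h3).C_mul c

theorem swapXX_gFun (m : ℕ) (c d : ℂ) : swapXX (gFun 2 0 m c d) = gFun 2 0 m c d := by
  simp only [gFun_two_zero, map_mul, map_sub, map_add, map_pow, swapXX_x₁, swapXX_x₂, swapXX_C]
  ring

theorem gFun_ne_zero_iff {m : ℕ} {c d : ℂ} : gFun 2 0 m c d ≠ 0 ↔ c ≠ 0 ∧ m ≠ 1 := by
  constructor
  · refine fun h => ⟨?_, ?_⟩
    · rintro rfl
      simp [gFun_two_zero] at h
    · rintro rfl
      simp [gFun_two_zero] at h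
  · rintro ⟨hc, hm⟩ h
    have := atOne_gFun m c d
    rw [h, map_zero] at this
    exact mul_ne_zero (Polynomial.C_ne_zero.mpr hc) (addPowDefect_ne_zero hm) this.symm

theorem atOne_prodXX (C : ℂ) (α β γ : ℕ) :
    atOne (MvPolynomial.C C * prodXX α β γ) = Polynomial.C C * prodY α β γ := by
  simp only [prodXX, prodY, map_mul, map_add, map_pow, atOne_x₁, atOne_x₂, atOne_C, one_pow,
    one_mul]

theorem isHomogeneous_C_mul_prodXX (C : ℂ) (α β γ : ℕ) :
    (MvPolynomial.C C * prodXX α β γ).IsHomogeneous (2 * α + 1 * β + 2 * γ) := by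
  have h1 : (x₁ * x₂).IsHomogeneous 2 := isHomogeneous_x₁.mul isHomogeneous_x₂
  have h2 : (x₁ ^ 2 + x₁ * x₂ + x₂ ^ 2).IsHomogeneous 2 :=
    ((isHomogeneous_x₁.pow 2).add h1).add (isHomogeneous_x₂.pow 2)
  exact (((h1.pow α).mul ((isHomogeneous_x₁.add isHomogeneous_x₂).pow β)).mul (h2.pow γ)).C_mul C

theorem swapXX_C_mul_prodXX (C : ℂ) (α β γ : ℕ) :
    swapXX (MvPolynomial.C C * prodXX α β γ) = MvPolynomial.C C * prodXX α β γ := by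
  simp only [prodXX, map_mul, map_add, map_pow, swapXX_x₁, swapXX_x₂, swapXX_C]
  rw [mul_comm x₂ x₁, add_comm x₂ x₁, show x₂ ^ 2 + x₁ * x₂ + x₁ ^ 2 = x₁ ^ 2 + x₁ * x₂ + x₂ ^ 2 by
    ring]

theorem prodY_ne_zero (α β γ : ℕ) : prodY α β γ ≠ 0 := by
  intro h
  have := congrArg (Polynomial.eval 1) h
  simp only [prodY, Polynomial.eval_mul, Polynomial.eval_pow, Polynomial.eval_add,
    Polynomial.eval_one, Polynomial.eval_X, Polynomial.eval_zero] at this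
  norm_num at this

theorem C_mul_prodXX_ne_zero {C : ℂ} (hC : C ≠ 0) (α β γ : ℕ) :
    MvPolynomial.C C * prodXX α β γ ≠ 0 := by
  intro h
  have := atOne_prodXX C α β γ
  rw [h, map_zero] at this
  exact mul_ne_zero (Polynomial.C_ne_zero.mpr hC) (prodY_ne_zero α β γ) this.symm

theorem C_mul_prodY_dvd_atOne_gFun_iff {C : ℂ} (hC : C ≠ 0) {α β γ : ℕ} (hα : α ≤ 1) (hβ : β ≤ 1)
    (hγ : γ ≤ 2) {m : ℕ} {c : ℂ} (d : ℂ) (hm : m ≠ 1) (hc : c ≠ 0) :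
    Polynomial.C C * prodY α β γ ∣ atOne (gFun 2 0 m c d) ↔ OrderCond α β γ m := by
  rw [atOne_gFun, (Polynomial.isUnit_C.mpr hC.isUnit).mul_left_dvd,
    (Polynomial.isUnit_C.mpr hc.isUnit).dvd_mul_left, prodY_dvd_addPowDefect_iff hα hβ hγ hm]

theorem orders_C_mul_prodXX {C : ℂ} (hC : C ≠ 0) {α β γ : ℕ} (hα : α ≤ 1) (hβ : β ≤ 1)
    (hγ : γ ≤ 2) :
    orders (MvPolynomial.C C * prodXX α β γ) = {m | m ≠ 1 ∧ OrderCond α β γ m} := by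
  ext m
  constructor
  · rintro ⟨c, d, h0, hd⟩
    obtain ⟨hc, hm⟩ := gFun_ne_zero_iff.mp h0
    have := map_dvd atOne hd
    rw [atOne_prodXX, C_mul_prodY_dvd_atOne_gFun_iff hC hα hβ hγ d hm hc] at this
    exact ⟨hm, this⟩
  · rintro ⟨hm, h⟩
    refine ⟨1, 0, gFun_ne_zero_iff.mpr ⟨one_ne_zero, hm⟩, ?_⟩
    refine dvd_of_atOne_dvd (isHomogeneous_C_mul_prodXX C α β γ) (isHomogeneous_gFun m 1 0)
      (swapXX_C_mul_prodXX C α β γ) (swapXX_gFun m 1 0) (C_mul_prodXX_ne_zero hC α β γ) ?_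
    rwa [atOne_prodXX, C_mul_prodY_dvd_atOne_gFun_iff hC hα hβ hγ 0 hm one_ne_zero]

theorem orders_C_mul_prodXX_infinite {C : ℂ} (hC : C ≠ 0) {α β γ : ℕ} (hα : α ≤ 1) (hβ : β ≤ 1)
    (hγ : γ ≤ 2) : (orders (MvPolynomial.C C * prodXX α β γ)).Infinite := by
  rw [orders_C_mul_prodXX hC hα hβ hγ]
  -- Orders congruent to 1 modulo 6, from 7 on, meet all the conditions at once.
  refine Set.infinite_of_injective_forall_mem (f := fun k : ℕ => 6 * k + 7)
    (fun a b h => by simpa using h) fun k => ⟨by omega, ?_⟩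
  simp only [OrderCond, Nat.ModEq]
  omega

theorem exists_eq_C_mul_prodXX {H : MvPolynomial (Fin 2 ⊕ Fin 0) ℂ} (hH : IsProper H)
    (hinf : (orders H).Infinite) : ∃ (C : ℂ) (α β γ : ℕ), C ≠ 0 ∧ α ≤ 1 ∧ β ≤ 1 ∧ γ ≤ 2 ∧
      H = MvPolynomial.C C * prodXX α β γ := by
  obtain ⟨z, w, hzw, hz, hw, hzi, hwi, hall, hfac⟩ := exists_one_add_add_sq
  have hHs := isProper_iff_swapXX.mp hH
  have hdvd : ∀ m ∈ orders H, m ≠ 1 ∧ atOne H ∣ addPowDefect m := by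
    rintro m ⟨c, d, h0, hd⟩
    obtain ⟨hc, hm⟩ := gFun_ne_zero_iff.mp h0
    have := map_dvd atOne hd
    rw [atOne_gFun, (Polynomial.isUnit_C.mpr hc.isUnit).dvd_mul_left] at this
    exact ⟨hm, this⟩
  obtain ⟨m, hmem⟩ := hinf.nonempty
  obtain ⟨hm, hmd⟩ := hdvd m hmem
  obtain ⟨c, d, h0, hd⟩ := hmem
  have hH0 : H ≠ 0 := ne_zero_of_dvd_ne_zero h0 hd
  obtain ⟨n, hn⟩ := (isHomogeneous_gFun m c d).exists_of_dvd h0 hd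
  have hh0 := atOne_ne_zero hn hH0
  have hroots : ∀ x, (atOne H).IsRoot x → x = 0 ∨ x = -1 ∨ x = z ∨ x = w := by
    intro x hx
    have hx' : {k : ℕ | 1 + x ^ k = (1 + x) ^ k}.Infinite := hinf.mono fun k hk => by
      have := hx.dvd (hdvd k hk).2
      rw [Polynomial.IsRoot, eval_addPowDefect] at this
      exact sub_eq_zero.mp this
    rcases eq_of_infinite_one_add_pow_eq hx' with h | h | h
    · exact Or.inl h
    · exact Or.inr (Or.inl h)
    · exact Or.inr (Or.inr (hall x h))
  have hle : ∀ x y : ℂ, x ≠ 0 → x⁻¹ = y →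
      (atOne H).rootMultiplicity x ≤ (atOne H).rootMultiplicity y := by
    rintro x y hx rfl
    rw [Polynomial.le_rootMultiplicity_iff hh0]
    exact X_sub_C_inv_pow_dvd_atOne hn hHs hH0 hx (Polynomial.pow_rootMultiplicity_dvd _ _)
  have hmul : (atOne H).rootMultiplicity z = (atOne H).rootMultiplicity w :=
    le_antisymm (hle z w (ne_zero_of_one_add_add_sq hz) hzi)
      (hle w z (ne_zero_of_one_add_add_sq hw) hwi)
  -- One order already bounds the multiplicities; infinitely many are needed only to locate the
  -- roots.
  have hbound : ∀ x, (atOne H).rootMultiplicity x ≤ (addPowDefect m).rootMultiplicity x :=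
    fun x => Polynomial.rootMultiplicity_le_rootMultiplicity_of_dvd (addPowDefect_ne_zero hm) hmd x
  have hlc := Polynomial.leadingCoeff_ne_zero.mpr hh0
  refine ⟨(atOne H).leadingCoeff, (atOne H).rootMultiplicity 0, (atOne H).rootMultiplicity (-1),
    (atOne H).rootMultiplicity z, hlc,
    (hbound 0).trans (rootMultiplicity_zero_addPowDefect_le hm),
    (hbound (-1)).trans (rootMultiplicity_neg_one_addPowDefect_le hm),
    (hbound z).trans (rootMultiplicity_addPowDefect_le hz hm), ?_⟩
  refine eq_of_atOne_eq hn (isHomogeneous_C_mul_prodXX _ _ _ _) hHs (swapXX_C_mul_prodXX _ _ _ _)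
    hH0 (C_mul_prodXX_ne_zero hlc _ _ _) ?_
  rw [atOne_prodXX]
  exact eq_C_mul_prodY hzw hz hw hfac hroots hmul

theorem isProper_and_orders_infinite_iff (H : MvPolynomial (Fin 2 ⊕ Fin 0) ℂ) :
    (IsProper H ∧ (orders H).Infinite) ↔
      ∃ (C : ℂ) (α β γ : ℕ), C ≠ 0 ∧ α ≤ 1 ∧ β ≤ 1 ∧ γ ≤ 2 ∧
        H = MvPolynomial.C C * prodXX α β γ := by
  constructor
  · rintro ⟨hH, hinf⟩
    exact exists_eq_C_mul_prodXX hH hinf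
  · rintro ⟨C, α, β, γ, hC, hα, hβ, hγ, rfl⟩
    exact ⟨isProper_iff_swapXX.mpr (swapXX_C_mul_prodXX C α β γ),
      orders_C_mul_prodXX_infinite hC hα hβ hγ⟩

theorem prodXX_mem_classH {α β γ : ℕ} (hα : α ≤ 1) (hβ : β ≤ 1) (hγ : γ ≤ 2) {n : ℕ}
    (hn : n ≠ 1 ∧ OrderCond α β γ n) (hmin : ∀ m, m ≠ 1 → OrderCond α β γ m → n ≤ m) :
    prodXX α β γ ∈ classH 2 0 n := by
  have h1 : prodXX α β γ = MvPolynomial.C 1 * prodXX α β γ := by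
    rw [MvPolynomial.C_1, one_mul]
  rw [h1]
  obtain ⟨hp, hi⟩ := (isProper_and_orders_infinite_iff _).mpr
    ⟨1, α, β, γ, one_ne_zero, hα, hβ, hγ, rfl⟩
  refine ⟨hp, hi, ?_⟩
  rw [orders_C_mul_prodXX one_ne_zero hα hβ hγ]
  exact ⟨hn, fun m hm => hmin m hm.1 hm.2⟩

theorem proposition4 :
    -- the function `G_m[c:d](1,y)`
    (∀ (m : ℕ) (c d : ℂ), atOne (gFun 2 0 m c d) =
      Polynomial.C c * (1 + Polynomial.X ^ m - (1 + Polynomial.X) ^ m)) ∧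
    -- the proper divisors of infinitely many `G_m`, in the symbols `x₁, x₂`
    (∀ H : MvPolynomial (Fin 2 ⊕ Fin 0) ℂ, (IsProper H ∧ (orders H).Infinite) ↔
      ∃ (C : ℂ) (α β γ : ℕ), C ≠ 0 ∧ α ≤ 1 ∧ β ≤ 1 ∧ γ ≤ 2 ∧
        H = MvPolynomial.C C * prodXX α β γ) ∧
    -- the same divisors as polynomials in `y`
    (∀ h : Polynomial ℂ,
      (∃ H : MvPolynomial (Fin 2 ⊕ Fin 0) ℂ,
        IsProper H ∧ (orders H).Infinite ∧ atOne H = h) ↔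
      ∃ (C : ℂ) (α β γ : ℕ), C ≠ 0 ∧ α ≤ 1 ∧ β ≤ 1 ∧ γ ≤ 2 ∧
        h = Polynomial.C C * prodY α β γ) ∧
    -- the orders at which each of them divides
    (∀ (C : ℂ) (α β γ : ℕ), C ≠ 0 → α ≤ 1 → β ≤ 1 → γ ≤ 2 →
      atOne (MvPolynomial.C C * prodXX α β γ) = Polynomial.C C * prodY α β γ ∧
      orders (MvPolynomial.C C * prodXX α β γ) = {m | m ≠ 1 ∧ OrderCond α β γ m} ∧
      ∀ (m : ℕ) (c d : ℂ), m ≠ 1 → c ≠ 0 →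
        (Polynomial.C C * prodY α β γ ∣ atOne (gFun 2 0 m c d) ↔ OrderCond α β γ m)) ∧
    -- the four basic divisors, with their lowest orders
    (prodXX 1 0 0 ∈ classH 2 0 2 ∧ prodXX 0 1 0 ∈ classH 2 0 3 ∧
      prodXX 0 0 1 ∈ classH 2 0 5 ∧ prodXX 0 0 2 ∈ classH 2 0 7) := by

  refine ⟨atOne_gFun, isProper_and_orders_infinite_iff, fun h => ⟨?_, ?_⟩, ?_, ?_⟩
  · rintro ⟨H, hH, hinf, rfl⟩
    obtain ⟨C, α, β, γ, hC, hα, hβ, hγ, rfl⟩ := exists_eq_C_mul_prodXX hH hinf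
    exact ⟨C, α, β, γ, hC, hα, hβ, hγ, atOne_prodXX C α β γ⟩
  · rintro ⟨C, α, β, γ, hC, hα, hβ, hγ, rfl⟩
    obtain ⟨hp, hi⟩ := (isProper_and_orders_infinite_iff _).mpr
      ⟨C, α, β, γ, hC, hα, hβ, hγ, rfl⟩
    exact ⟨_, hp, hi, atOne_prodXX C α β γ⟩
  · intro C α β γ hC hα hβ hγ
    exact ⟨atOne_prodXX C α β γ, orders_C_mul_prodXX hC hα hβ hγ, fun m c d hm hc =>
      C_mul_prodY_dvd_atOne_gFun_iff hC hα hβ hγ d hm hc⟩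
  · refine ⟨prodXX_mem_classH le_rfl zero_le_one zero_le_two ?_ fun m => ?_,
      prodXX_mem_classH zero_le_one le_rfl zero_le_two ?_ fun m => ?_,
      prodXX_mem_classH zero_le_one zero_le_one one_le_two ?_ fun m => ?_,
      prodXX_mem_classH zero_le_one zero_le_one le_rfl ?_ fun m => ?_⟩
    all_goals
      simp [OrderCond, Nat.ModEq] <;> omega
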